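/- Let $E$, $B$, $Y$ be topological spaces, where $B$ has the homotopy type of a CW complex, and let $E\xrightarrow{p}B\xrightarrow{f}Y$ be continuous maps. An open set $U\subseteq B$ is called $f$-categorical if there is a continuous map $s\colon U\to E$ with $f\circ p\circ s\simeq f|_U$, and the $f$-sectional category $\operatorname{secat}_f(p)\in\{0,1,2,\dots,\infty\}$ is the least $n$ such that $B$ can be covered by $n+1$ $f$-categorical open sets ($\infty$ if there is no such $n$). Let $f\circ p=q\circ j$ be any factorization in which $j\colon E\to Z$ is a (Hurewicz) cofibration and $q\colon Z\to Y$ is a homotopy equivalence. For $n\ge 0$ let $$T^n(j)=\{(x_0,\dots,x_n)\in Z^{n+1} : x_k\in\operatorname{Im} j\text{ for some }k\}$$ be the $n$-th fat wedge of $j$, let $h_n\colon T^n(j)\hookrightarrow Z^{n+1}\xrightarrow{q^{n+1}}Y^{n+1}$ be the composition of the inclusion with $q^{n+1}$, and let $\Delta^n\colon Y\to Y^{n+1}$ be the diagonal map. Then $\operatorname{secat}_f(p)$ is the least integer $n\ge 0$ for which $\Delta^n\circ f\colon B\to Y^{n+1}$ factors up to homotopy through $h_n$, that is, for which there is a continuous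 map $\xi\colon B\to T^n(j)$ with $h_n\circ\xi\simeq\Delta^n\circ f$; and $\operatorname{secat}_f(p)=\infty$ if there is no such $n$. (Homotopies are free.) -/

import Mathlib

open scoped unitInterval

universe u

/-- A space has the homotopy type of a CW complex if it is homotopy equivalent to a Hausdorff
space that carries a CW structure. -/
def HasCWHomotopyType (B : Type u) [TopologicalSpace B] : Prop :=
  ∃ (K : Type u) (_ : TopologicalSpace K) (_ : T2Space K),
    Nonempty (Topology.CWComplex (Set.univ : Set K)) ∧
      Nonempty (ContinuousMap.HomotopyEquiv B K)

/-- A (Hurewicz) cofibration: a map with the homotopy extension property with respect to every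
space. -/
def IsHurewiczCofibration {E Z : Type u} [TopologicalSpace E] [TopologicalSpace Z]
    (j : C(E, Z)) : Prop :=
  ∀ (W : Type u) [TopologicalSpace W] (g : C(Z, W)) (H : C(E × I, W)),
    (∀ e, H (e, 0) = g (j e)) →
      ∃ G : C(Z × I, W), (∀ z, G (z, 0) = g z) ∧ ∀ e t, G (j e, t) = H (e, t)

/-- A continuous map that is a homotopy equivalence. -/
def IsHomotopyEquivalence {Z Y : Type*} [TopologicalSpace Z] [TopologicalSpace Y]
    (q : C(Z, Y)) : Prop :=
  ∃ e : ContinuousMap.HomotopyEquiv Z Y, e.toFun = q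

section Secat

variable {E B Y : Type*} [TopologicalSpace E] [TopologicalSpace B] [TopologicalSpace Y]

/-- `U ⊆ B` is `f`-categorical (for `p`): it is open and there is a map `s : U → E` with
`f ∘ p ∘ s` homotopic to the restriction of `f` to `U`. -/
def IsFCategorical (p : C(E, B)) (f : C(B, Y)) (U : Set B) : Prop :=
  IsOpen U ∧ ∃ s : C(U, E), ContinuousMap.Homotopic ((f.comp p).comp s) (f.restrict U)

/-- `B` is covered by `n + 1` sets that are `f`-categorical. -/
def HasFCategoricalCover (p : C(E, B)) (f : C(B, Y)) (n : ℕ) : Prop :=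
  ∃ U : Fin (n + 1) → Set B, (∀ i, IsFCategorical p f (U i)) ∧ ⋃ i, U i = Set.univ

/-- The `f`-sectional category of `p`: the least `n ≤ ∞` such that `B` has a cover by `n + 1`
open `f`-categorical sets (it is `⊤` if there is no such finite cover). -/
noncomputable def fSecat (p : C(E, B)) (f : C(B, Y)) : ℕ∞ :=
  sInf ((fun n : ℕ => (n : ℕ∞)) '' {n : ℕ | HasFCategoricalCover p f n})

end Secat

section FatWedge

variable {E Z Y B : Type*} [TopologicalSpace E] [TopologicalSpace Z] [TopologicalSpace Y]
  [TopologicalSpace B]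

/-- The `n`-th fat wedge `T^n(j)` of `j : E → Z`, a subspace of `Z^{n+1}`. -/
abbrev FatWedge (j : C(E, Z)) (n : ℕ) : Type _ :=
  {x : Fin (n + 1) → Z // ∃ k, x k ∈ Set.range j}

/-- The composition `h_n : T^n(j) ↪ Z^{n+1} → Y^{n+1}` of the inclusion with `q^{n+1}`. -/
def fatWedgeMap (j : C(E, Z)) (q : C(Z, Y)) (n : ℕ) :
    C(FatWedge j n, Fin (n + 1) → Y) where
  toFun x i := q (x.1 i)
  continuous_toFun := continuous_pi fun i =>
    q.continuous.comp ((continuous_apply i).comp continuous_subtype_val)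

/-- The diagonal `Δ^n : Y → Y^{n+1}`. -/
def diagonalMap (Y : Type*) [TopologicalSpace Y] (n : ℕ) : C(Y, Fin (n + 1) → Y) where
  toFun y _ := y
  continuous_toFun := by fun_prop

/-- `Δ^n ∘ f : B → Y^{n+1}` factors up to homotopy through `h_n : T^n(j) → Y^{n+1}`. -/
def HomotopyFactorsThroughFatWedge (f : C(B, Y)) (j : C(E, Z)) (q : C(Z, Y)) (n : ℕ) : Prop :=
  ∃ ξ : C(B, FatWedge j n),
    ContinuousMap.Homotopic ((fatWedgeMap j q n).comp ξ) ((diagonalMap Y n).comp f)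

end FatWedge

/-! ### Tietze extension and normality for CW complexes. -/

section CWNormal

open Topology Metric Set

variable {K : Type*} [TopologicalSpace K] [T2Space K] [CWComplex (univ : Set K)]

/-! For each fixed `n`, a categorical cover and a factorization through the fat wedge can be turned
into each other. Given `ξ`, its coordinates `x i` satisfy `q ∘ x i ≃ f`. By
`IsHurewiczCofibration.exists_deformation`, an open `N ⊇ Im j` deforms in `Z` into `j ∘ r`, so the
preimages of `N` under the `x i` are categorical, and they cover since some coordinate always lies
in `Im j`. Conversely, move the cover to a CW complex `K`, which is normal, and shrink it to closed
sets `C i`. By `exists_homotopic_eqOn_of_isClosed` a single map `φ : K → Z` representing `f` is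
deformed, once for each `i`, into `Im j` over `C i`; the results are the coordinates of a map to the
fat wedge. -/

theorem continuousOn_closedCell {u : K → ℝ} {n : ℕ} {i : RelCWComplex.cell (univ : Set K) n}
    (hu : ContinuousOn (u ∘ RelCWComplex.map (C := (univ : Set K)) n i) (closedBall 0 1)) :
    ContinuousOn u (RelCWComplex.closedCell (C := (univ : Set K)) n i) := by
  rw [continuousOn_iff_isClosed]
  intro t ht
  -- The image of a compact set in a Hausdorff space is closed, so the closed cell carries the
  -- quotient topology of the ball.
  refine ⟨RelCWComplex.map (C := (univ : Set K)) n i ''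
    (closedBall 0 1 ∩ (u ∘ RelCWComplex.map (C := (univ : Set K)) n i) ⁻¹' t), ?_, ?_⟩
  · refine IsCompact.isClosed (IsCompact.image_of_continuousOn ?_
      ((RelCWComplex.continuousOn n i).mono inter_subset_left))
    exact (isCompact_closedBall _ _).of_isClosed_subset
      (hu.preimage_isClosed_of_isClosed isClosed_closedBall ht) inter_subset_left
  · ext x
    constructor
    · rintro ⟨hx, y, hy, rfl⟩
      exact ⟨⟨y, ⟨hy, hx⟩, rfl⟩, y, hy, rfl⟩
    · rintro ⟨⟨y, ⟨hy, hyt⟩, rfl⟩, hx⟩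
      exact ⟨hyt, hx⟩

theorem continuous_of_comp_map {u : K → ℝ}
    (hu : ∀ n i, ContinuousOn (u ∘ RelCWComplex.map (C := (univ : Set K)) n i) (closedBall 0 1)) :
    Continuous u := by
  rw [continuous_iff_isClosed]
  intro t ht
  rw [CWComplex.closed (univ : Set K) _ (subset_univ _)]
  intro n i
  rw [inter_comm]
  exact (continuousOn_closedCell (hu n i)).preimage_isClosed_of_isClosed
    RelCWComplex.isClosed_closedCell ht

/-- Closure finiteness: the attaching map lands in finitely many closed cells of lower dimension,
over which continuity glues. -/
theorem continuousOn_comp_map_sphere {u : K → ℝ} {n : ℕ}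
    (hu : ∀ m < n, ∀ i, ContinuousOn (u ∘ RelCWComplex.map (C := (univ : Set K)) m i)
      (closedBall 0 1)) (i : RelCWComplex.cell (univ : Set K) n) :
    ContinuousOn (u ∘ RelCWComplex.map (C := (univ : Set K)) n i) (sphere 0 1) := by
  obtain ⟨J, hJ⟩ := CWComplex.mapsTo (C := (univ : Set K)) n i
  refine ContinuousOn.comp (t := ⋃ (x : Σ m : Fin n, {j // j ∈ J m}),
    RelCWComplex.closedCell (C := (univ : Set K)) x.1 x.2.1) ?_
    ((RelCWComplex.continuousOn n i).mono sphere_subset_closedBall) ?_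
  · exact (locallyFinite_of_finite _).continuousOn_iUnion
      (fun _ => RelCWComplex.isClosed_closedCell)
      (fun x => continuousOn_closedCell (hu x.1 x.1.2 x.2.1))
  · intro y hy
    have := hJ hy
    simp only [mem_iUnion] at this ⊢
    obtain ⟨m, hm, j, hj, h⟩ := this
    exact ⟨⟨⟨m, hm⟩, j, hj⟩, h⟩

/-- Extending a function over the cells of dimension `n`, without changing it on the closed set
`A` or on the cells of lower dimension. -/
theorem exists_extension_cells {A : Set K} (hA : IsClosed A) {u : K → ℝ} (huA : ContinuousOn u A)
    {n : ℕ} (hu : ∀ m < n, ∀ i, ContinuousOn (u ∘ RelCWComplex.map (C := (univ : Set K)) m i)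
      (closedBall 0 1)) :
    ∃ v : K → ℝ, EqOn v u A ∧
      (∀ m < n, ∀ i, EqOn v u (RelCWComplex.closedCell (C := (univ : Set K)) m i)) ∧
      ∀ i, ContinuousOn (v ∘ RelCWComplex.map (C := (univ : Set K)) n i) (closedBall 0 1) := by
  classical
  have key : ∀ i : RelCWComplex.cell (univ : Set K) n, ∃ F : C(Fin n → ℝ, ℝ), ∀ y ∈ closedBall 0 1,
      y ∈ sphere 0 1 ∨ RelCWComplex.map (C := (univ : Set K)) n i y ∈ A →
        F y = u (RelCWComplex.map (C := (univ : Set K)) n i y) := by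
    intro i
    have hc := (RelCWComplex.continuousOn (C := (univ : Set K)) n i)
    have h1 := hc.preimage_isClosed_of_isClosed isClosed_closedBall hA
    have h2 : ContinuousOn (u ∘ RelCWComplex.map (C := (univ : Set K)) n i)
        (sphere 0 1 ∪ (closedBall 0 1 ∩ RelCWComplex.map (C := (univ : Set K)) n i ⁻¹' A)) :=
      (continuousOn_comp_map_sphere hu i).union_of_isClosed
        (huA.comp (hc.mono inter_subset_left) fun y hy => hy.2) isClosed_sphere h1
    -- Tietze in the ball, with values prescribed on the sphere and over `A`.
    obtain ⟨F, hF⟩ := ContinuousMap.exists_restrict_eq (isClosed_sphere.union h1)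
      ⟨_, h2.domRestrict⟩
    refine ⟨F, fun y hy h => ?_⟩
    have hy' : y ∈ (sphere 0 1 ∪
        (closedBall 0 1 ∩ RelCWComplex.map (C := (univ : Set K)) n i ⁻¹' A)) :=
      h.imp id fun h => ⟨hy, h⟩
    exact DFunLike.congr_fun hF ⟨y, hy'⟩
  choose F hF using key
  let v : K → ℝ := fun x =>
    if h : ∃ i, x ∈ RelCWComplex.openCell (C := (univ : Set K)) n i then
      F h.choose ((RelCWComplex.map (C := (univ : Set K)) n h.choose).symm x) else u x
  have hv1 : ∀ i, ∀ y ∈ ball (0 : Fin n → ℝ) 1,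
      v (RelCWComplex.map (C := (univ : Set K)) n i y) = F i y := by
    intro i y hy
    have hi : RelCWComplex.map (C := (univ : Set K)) n i y ∈
      RelCWComplex.openCell (C := (univ : Set K)) n i := mem_image_of_mem _ hy
    have h : ∃ i', RelCWComplex.map (C := (univ : Set K)) n i y ∈
      RelCWComplex.openCell (C := (univ : Set K)) n i' := ⟨i, hi⟩
    have e : h.choose = i := by
      have := RelCWComplex.eq_of_not_disjoint_openCell
        (not_disjoint_iff.2 ⟨_, h.choose_spec, hi⟩)
      simpa using this
    simp only [v]
    rw [dif_pos h, e, PartialEquiv.left_inv]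
    rwa [RelCWComplex.source_eq]
  have hv2 : ∀ x, (∀ i, x ∉ RelCWComplex.openCell (C := (univ : Set K)) n i) → v x = u x := by
    intro x hx
    simp only [v]
    rw [dif_neg]
    rintro ⟨i, hi⟩
    exact hx i hi
  have hlow : ∀ m < n, ∀ i, ∀ x ∈ RelCWComplex.closedCell (C := (univ : Set K)) m i, ∀ i',
      x ∉ RelCWComplex.openCell (C := (univ : Set K)) n i' := by
    intro m hm i x hx i' hx'
    have := RelCWComplex.disjoint_skeletonLT_openCell (C := (univ : Set K)) (n := (m + 1 : ℕ))
      (m := n) (j := i') (by exact_mod_cast hm)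
    exact disjoint_left.1 this (RelCWComplex.closedCell_subset_skeletonLT m i hx) hx'
  refine ⟨v, ?_, ?_, ?_⟩
  · intro x hx
    by_cases h : ∃ i, x ∈ RelCWComplex.openCell (C := (univ : Set K)) n i
    · obtain ⟨i, y, hy, rfl⟩ := h
      rw [hv1 i y hy]
      exact hF i y (ball_subset_closedBall hy) (Or.inr hx)
    · exact hv2 x (not_exists.1 h)
  · intro m hm i x hx
    exact hv2 x (hlow m hm i x hx)
  · intro i
    refine (F i).continuous.continuousOn.congr fun y hy => ?_
    rcases (mem_closedBall.1 hy).lt_or_eq with h | h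
    · exact hv1 i y h
    · rw [hF i y hy (Or.inl h)]
      refine hv2 _ ?_
      have hfr : RelCWComplex.map (C := (univ : Set K)) n i y ∈
        RelCWComplex.cellFrontier (C := (univ : Set K)) n i := mem_image_of_mem _ h
      intro i' hx'
      have := RelCWComplex.disjoint_skeletonLT_openCell (C := (univ : Set K)) (n := n)
        (m := n) (j := i') le_rfl
      exact disjoint_left.1 this (RelCWComplex.cellFrontier_subset_skeletonLT n i hfr) hx'

/-- Tietze extension for Hausdorff CW complexes. -/
theorem exists_extension_of_cwComplex {A : Set K} (hA : IsClosed A) {u : K → ℝ}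
    (huA : ContinuousOn u A) : ∃ v : C(K, ℝ), EqOn v u A := by
  -- Stage `n` controls only cells of dimension below `n`, so `u` itself, arbitrary off `A`, can
  -- serve as stage `0`.
  let P : ℕ → (K → ℝ) → Prop := fun n w => EqOn w u A ∧ ∀ m < n, ∀ i,
    ContinuousOn (w ∘ RelCWComplex.map (C := (univ : Set K)) m i) (closedBall 0 1)
  have step : ∀ n (w : {w // P n w}), ∃ w' : {w // P (n + 1) w}, ∀ m < n, ∀ i,
      EqOn w'.1 w.1 (RelCWComplex.closedCell (C := (univ : Set K)) m i) := by
    rintro n ⟨w, hw1, hw2⟩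
    obtain ⟨w', h1, h2, h3⟩ := exists_extension_cells hA (huA.congr hw1) hw2
    refine ⟨⟨w', h1.trans hw1, fun m hm i => ?_⟩, h2⟩
    rcases Nat.lt_succ_iff_lt_or_eq.1 hm with h | rfl
    · exact (hw2 m h i).congr fun y hy => h2 m h i (mem_image_of_mem _ hy)
    · exact h3 i
  choose F hF using step
  let s : ∀ n, {w // P n w} := fun n =>
    Nat.rec ⟨u, fun _ _ => rfl, fun m hm => absurd hm (Nat.not_lt_zero m)⟩ (fun n w => F n w) n
  have hs : ∀ n m, m < n → ∀ i, ∀ x ∈ RelCWComplex.closedCell (C := (univ : Set K)) m i,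
      (s n).1 x = (s (m + 1)).1 x := by
    intro n m hmn i x hx
    induction n, hmn using Nat.le_induction with
    | base => rfl
    | succ k hk ih => exact (hF k (s k) m hk i hx).trans ih
  have hcov : ∀ x : K, ∃ n, ∃ i, x ∈ RelCWComplex.closedCell (C := (univ : Set K)) n i := by
    intro x
    have := (CWComplex.union (C := (univ : Set K))).symm ▸ mem_univ x
    simpa only [mem_iUnion] using this
  choose N c hN using hcov
  have hv : ∀ m i, ∀ x ∈ RelCWComplex.closedCell (C := (univ : Set K)) m i,
      (s (N x + 1)).1 x = (s (m + 1)).1 x := by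
    intro m i x hx
    rw [← hs (max (N x) m + 1) m (by omega) i x hx,
      ← hs (max (N x) m + 1) (N x) (by omega) _ x (hN x)]
  -- Values on an `m`-cell are final from stage `m + 1` on; `hv` makes the choice of cell through
  -- `x` immaterial.
  refine ⟨⟨fun x => (s (N x + 1)).1 x, continuous_of_comp_map fun n i => ?_⟩, fun x hx => ?_⟩
  · exact ((s (n + 1)).2.2 n n.lt_succ_self i).congr fun y hy => hv n i _ (mem_image_of_mem _ hy)
  · exact (s (N x + 1)).2.1 hx

variable (K) in
/-- A Hausdorff CW complex is a normal space. -/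
theorem normalSpace_of_cwComplex : NormalSpace K := by
  classical
  refine ⟨fun A B hA hB hAB => ?_⟩
  have h0 : EqOn (B.indicator (1 : K → ℝ)) (fun _ => 0) A := fun x hx =>
    indicator_of_notMem (disjoint_left.1 hAB hx) _
  have h1 : EqOn (B.indicator (1 : K → ℝ)) (fun _ => 1) B := fun x hx => indicator_of_mem hx _
  obtain ⟨v, hv⟩ := exists_extension_of_cwComplex (hA.union hB)
    ((continuousOn_const.congr h0).union_of_isClosed (continuousOn_const.congr h1) hA hB)
  refine ⟨v ⁻¹' Iio (1 / 2), v ⁻¹' Ioi (1 / 2), isOpen_Iio.preimage v.continuous,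
    isOpen_Ioi.preimage v.continuous, fun x hx => ?_, fun x hx => ?_, ?_⟩
  · rw [mem_preimage, hv (Or.inl hx), h0 hx]; norm_num
  · rw [mem_preimage, hv (Or.inr hx), h1 hx]; norm_num
  · exact Disjoint.preimage _ (disjoint_left.2 fun x (h : x < 1 / 2) (h' : 1 / 2 < x) => lt_asymm h h')

end CWNormal

/-! ### Cofibrations, and from the fat wedge to covers. -/

section Cofibration

/-- `Option E` with the topology in which `none` has the whole space as its only neighbourhood:
continuous maps into it are the maps into `E` defined on an open subset. -/
@[reducible]
def partialMapTopology (E : Type*) [TopologicalSpace E] : TopologicalSpace (Option E) where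
  IsOpen s := (none ∈ s → s = Set.univ) ∧ IsOpen (some ⁻¹' s : Set E)
  isOpen_univ := by simp
  isOpen_inter s t hs ht :=
    ⟨fun h => by rw [hs.1 h.1, ht.1 h.2, Set.univ_inter], hs.2.inter ht.2⟩
  isOpen_sUnion S hS := by
    refine ⟨?_, ?_⟩
    · rintro ⟨s, hs, h⟩
      exact Set.univ_subset_iff.1 (((hS s hs).1 h) ▸ Set.subset_sUnion_of_mem hs)
    · rw [Set.preimage_sUnion]
      exact isOpen_biUnion fun s hs => (hS s hs).2

/-- Around the image of a cofibration `j : E → Z` the identity of `Z` deforms into `j`. -/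
theorem IsHurewiczCofibration.exists_deformation {E Z : Type u} [TopologicalSpace E]
    [TopologicalSpace Z] {j : C(E, Z)} (hj : IsHurewiczCofibration j) :
    ∃ (D : C(Z × I, Z)) (N : Set Z) (r : C(N, E)), IsOpen N ∧ Set.range j ⊆ N ∧
      (∀ z, D (z, 0) = z) ∧ ∀ z : N, D (z, 1) = j (r z) := by
  classical
  let _ := partialMapTopology E
  -- The test space for homotopy extension: a point of `Z` with an optional `j`-preimage. The
  -- homotopy `H` switches the preimage on as soon as `t > 0`; at time `1` the extension `G` has one
  -- on an open set, which is `N`.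
  let W := {w : Z × Option E // ∀ e, w.2 = some e → w.1 = j e}
  let g : C(Z, W) := ⟨fun z => ⟨(z, none), by simp⟩, by fun_prop⟩
  have hH : Continuous fun x : E × I => if x.2 = 0 then (none : Option E) else some x.1 := by
    refine continuous_def.2 fun s hs => ?_
    by_cases h : none ∈ s
    · rw [hs.1 h, Set.preimage_univ]; exact isOpen_univ
    · have : (fun x : E × I => if x.2 = 0 then (none : Option E) else some x.1) ⁻¹' s =
          (some ⁻¹' s) ×ˢ {0}ᶜ := by
        ext ⟨e, t⟩
        by_cases ht : t = 0 <;> simp [ht, h]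
      rw [this]
      exact hs.2.prod isOpen_compl_singleton
  have hW : ∀ (x : E × I) (e : E),
      (j x.1, if x.2 = 0 then (none : Option E) else some x.1).2 = some e → j x.1 = j e := by
    intro x e he
    by_cases ht : x.2 = 0
    · simp [ht] at he
    · simp only [ht, if_false, Option.some.injEq] at he
      rw [he]
  let H : C(E × I, W) := ⟨fun x => ⟨(j x.1, if x.2 = 0 then none else some x.1), hW x⟩,
    Continuous.subtype_mk ((j.continuous.comp continuous_fst).prodMk hH) hW⟩
  obtain ⟨G, hG0, hG1⟩ := hj W g H (by intro e; simp [H, g])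
  let π : C(W, Z) := ⟨fun w => w.1.1, by fun_prop⟩
  let κ : C(W, Option E) := ⟨fun w => w.1.2, by fun_prop⟩
  let k : Z → Option E := fun z => κ (G (z, 1))
  have hk : Continuous k := by fun_prop
  have hsome : ∀ z : {z | (k z).isSome}, k z = some ((k z).get z.2) := fun z => by simp
  refine ⟨π.comp G, {z | (k z).isSome},
    ⟨fun z => (k z).get z.2, ?_⟩, ?_, ?_, ?_, ?_⟩
  · refine continuous_def.2 fun s hs => ?_
    have ho : IsOpen (some '' s : Set (Option E)) :=
      ⟨by simp, by rwa [Set.preimage_image_eq _ (Option.some_injective E)]⟩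
    convert (ho.preimage hk).preimage continuous_subtype_val using 1
    ext z
    constructor
    · exact fun h => ⟨_, h, (hsome z).symm⟩
    · rintro ⟨e, he, h⟩
      have : (k z).get z.2 = e := Option.some.inj ((hsome z).symm.trans h.symm)
      exact Set.mem_preimage.2 (this ▸ he)
  · have ho : IsOpen ({o | o.isSome} : Set (Option E)) := ⟨by simp, by simp⟩
    exact ho.preimage hk
  · rintro _ ⟨e, rfl⟩
    simp [k, κ, hG1, H]
  · intro z
    simp [hG0, g, π]
  · intro z
    exact (G (z.1, 1)).2 _ (hsome z)

/-- The section over the preimage of `N` under `x i` is `r ∘ x i`: there `f ∘ p ∘ r ∘ x i = q ∘ j ∘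
r ∘ x i ≃ q ∘ x i ≃ f`. -/
theorem hasFCategoricalCover_of_homotopyFactorsThroughFatWedge {E B Y Z : Type u}
    [TopologicalSpace E] [TopologicalSpace B] [TopologicalSpace Y] [TopologicalSpace Z]
    {p : C(E, B)} {f : C(B, Y)} {j : C(E, Z)} {q : C(Z, Y)} (hj : IsHurewiczCofibration j)
    (hqj : q.comp j = f.comp p) {n : ℕ} (h : HomotopyFactorsThroughFatWedge f j q n) :
    HasFCategoricalCover p f n := by
  obtain ⟨ξ, hξ⟩ := h
  obtain ⟨D, N, r, hN, hjN, hD0, hD1⟩ := hj.exists_deformation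
  let ev : ∀ (i : Fin (n + 1)) (X : Type u) [TopologicalSpace X], C(Fin (n + 1) → X, X) :=
    fun i X _ => ⟨fun x => x i, continuous_apply i⟩
  let x : Fin (n + 1) → C(B, Z) := fun i =>
    (ev i Z).comp (ContinuousMap.comp ⟨Subtype.val, continuous_subtype_val⟩ ξ)
  have hx : ∀ i, (q.comp (x i)).Homotopic f := fun i =>
    (ContinuousMap.Homotopic.refl (ev i Y)).comp hξ
  refine ⟨fun i => x i ⁻¹' N, fun i => ⟨hN.preimage (x i).continuous, ?_⟩, ?_⟩
  · let x' : C(x i ⁻¹' N, N) := ⟨fun b => ⟨x i b, b.2⟩, by fun_prop⟩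
    refine ⟨r.comp x', ?_⟩
    have h1 : ((x i).restrict (x i ⁻¹' N)).Homotopic (j.comp (r.comp x')) :=
      ⟨{ toFun := fun a => D (x i a.2, a.1)
         continuous_toFun := by fun_prop
         map_zero_left := fun b => hD0 _
         map_one_left := fun b => hD1 (x' b) }⟩
    have h2 : ((f.comp p).comp (r.comp x')).Homotopic (q.comp ((x i).restrict (x i ⁻¹' N))) := by
      rw [← hqj]
      exact (ContinuousMap.Homotopic.refl q).comp h1.symm
    exact h2.trans
      ((hx i).comp (ContinuousMap.Homotopic.refl ⟨Subtype.val, continuous_subtype_val⟩))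
  · refine Set.eq_univ_of_forall fun b => ?_
    obtain ⟨i, hi⟩ := (ξ b).2
    exact Set.mem_iUnion.2 ⟨i, hjN hi⟩

end Cofibration

/-! ### Damping homotopies, and from covers to the fat wedge. -/

section Normal

/-- In a normal space, a homotopy from a map `φ` that is defined only over an open set `V` can be
damped out away from a closed set `C ⊆ V`. -/
theorem exists_homotopic_eqOn_of_isClosed {X Z : Type*} [TopologicalSpace X] [TopologicalSpace Z]
    [NormalSpace X] {C V : Set X} (hC : IsClosed C) (hV : IsOpen V) (hCV : C ⊆ V) {φ : C(X, Z)}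
    {g : C(V, Z)} (h : (φ.restrict V).Homotopic g) :
    ∃ ξ : C(X, Z), φ.Homotopic ξ ∧ ∀ x (hx : x ∈ C), ξ x = g ⟨x, hCV hx⟩ := by
  classical
  obtain ⟨H⟩ := h
  obtain ⟨O, hO, hCO, hOV⟩ := normal_exists_closure_subset hC hV hCV
  obtain ⟨l, hl0, hl1, hl⟩ := exists_continuous_zero_one_of_isClosed hO.isClosed_compl hC
    (Set.disjoint_left.2 fun x hx hx' => hx (hCO hx'))
  let l' : C(X, I) := ⟨fun x => ⟨l x, hl x⟩, by fun_prop⟩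
  -- Time is rescaled by the Urysohn function `l'`, so `G` is stationary off `O` and runs fully on
  -- `C`; it glues over `V` and the complement of `closure O`.
  let G : I × X → Z := fun a => if h : a.2 ∈ V then H (a.1 * l' a.2, ⟨a.2, h⟩) else φ a.2
  have hG1 : ∀ t x (hx : x ∈ V), G (t, x) = H (t * l' x, ⟨x, hx⟩) := fun t x hx => dif_pos hx
  have hG2 : ∀ t x, l' x = 0 → G (t, x) = φ x := by
    intro t x hx
    by_cases h : x ∈ V
    · rw [hG1 t x h, hx, mul_zero]
      exact H.apply_zero _
    · exact dif_neg h
  have hG0 : ∀ x, G (0, x) = φ x := by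
    intro x
    by_cases h : x ∈ V
    · rw [hG1 0 x h, zero_mul]
      exact H.apply_zero _
    · exact dif_neg h
  have hl'0 : ∀ x ∉ O, l' x = 0 := fun x hx => Subtype.ext (hl0 hx)
  have hG : Continuous G := by
    have c1 : ContinuousOn G (Prod.snd ⁻¹' V) := by
      rw [continuousOn_iff_continuous_domRestrict]
      have : (Prod.snd ⁻¹' V).domRestrict G = fun a : (Prod.snd ⁻¹' V : Set (I × X)) =>
          H (a.1.1 * l' a.1.2, ⟨a.1.2, a.2⟩) := by
        ext a
        exact hG1 _ _ a.2
      rw [this]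
      fun_prop
    have c2 : ContinuousOn G (Prod.snd ⁻¹' (closure O)ᶜ) :=
      (φ.continuous.comp continuous_snd).continuousOn.congr fun a ha =>
        hG2 a.1 a.2 (hl'0 _ fun h => ha (subset_closure h))
    have := c1.union_of_isOpen c2 (hV.preimage continuous_snd)
      (isClosed_closure.isOpen_compl.preimage continuous_snd)
    rw [← continuousOn_univ]
    convert this
    symm
    refine Set.eq_univ_of_forall fun a => ?_
    by_cases h : a.2 ∈ closure O
    · exact Or.inl (hOV h)
    · exact Or.inr h
  refine ⟨⟨fun x => G (1, x), by fun_prop⟩, ⟨⟨⟨G, hG⟩, hG0, fun x => rfl⟩⟩, fun x hx => ?_⟩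
  have : l' x = 1 := Subtype.ext (hl1 hx)
  change G (1, x) = _
  rw [hG1 1 x (hCV hx), this, mul_one]
  exact H.apply_one _

/-- Normality is not a homotopy invariant, so the work is done on `K` and carried back along `α`. -/
theorem homotopyFactorsThroughFatWedge_of_hasFCategoricalCover {E B Y Z : Type u}
    [TopologicalSpace E] [TopologicalSpace B] [TopologicalSpace Y] [TopologicalSpace Z]
    (hB : HasCWHomotopyType B) {p : C(E, B)} {f : C(B, Y)} {j : C(E, Z)} {q : C(Z, Y)}
    (hq : IsHomotopyEquivalence q) (hqj : q.comp j = f.comp p) {n : ℕ}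
    (h : HasFCategoricalCover p f n) : HomotopyFactorsThroughFatWedge f j q n := by
  obtain ⟨K, _, _, ⟨hK⟩, ⟨α⟩⟩ := hB
  obtain ⟨e, rfl⟩ := hq
  obtain ⟨U, hU, hUc⟩ := h
  have := normalSpace_of_cwComplex K
  let V : Fin (n + 1) → Set K := fun i => α.invFun ⁻¹' U i
  have hV : ∀ i, IsOpen (V i) := fun i => (hU i).1.preimage α.invFun.continuous
  obtain ⟨C, hCc, hC, hCV⟩ := exists_iUnion_eq_closed_subset hV (fun x => Set.toFinite _)
    (show ⋃ i, V i = Set.univ by rw [← Set.preimage_iUnion, hUc, Set.preimage_univ])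
  let φ : C(K, Z) := e.invFun.comp (f.comp α.invFun)
  have key : ∀ i, ∃ ξ : C(K, Z), φ.Homotopic ξ ∧ ∀ x ∈ C i, ξ x ∈ Set.range j := by
    intro i
    obtain ⟨s, hs⟩ := (hU i).2
    let β : C(V i, U i) := ⟨fun x => ⟨α.invFun x, x.2⟩, by fun_prop⟩
    have h1 : (φ.restrict (V i)).Homotopic (j.comp (s.comp β)) := by
      have a : (φ.restrict (V i)).Homotopic
          (e.invFun.comp (((f.comp p).comp s).comp β)) :=
        (ContinuousMap.Homotopic.refl e.invFun).comp
          (hs.symm.comp (ContinuousMap.Homotopic.refl β))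
      rw [← hqj] at a
      exact a.trans (e.left_inv.comp (ContinuousMap.Homotopic.refl (j.comp (s.comp β))))
    obtain ⟨ξ, hξ, hξC⟩ := exists_homotopic_eqOn_of_isClosed (hC i) (hV i) (hCV i) h1
    exact ⟨ξ, hξ, fun x hx => ⟨_, (hξC x hx).symm⟩⟩
  choose ξ hξ hξC using key
  -- The sets `C i` still cover `K`, so at each point some coordinate lies in `Im j`.
  let Ξ : C(K, FatWedge j n) := ⟨fun x => ⟨fun i => ξ i x, by
    obtain ⟨i, hi⟩ := Set.mem_iUnion.1 (hCc.symm ▸ Set.mem_univ x)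
    exact ⟨i, hξC i x hi⟩⟩, by fun_prop⟩
  refine ⟨Ξ.comp α.toFun, ?_⟩
  have h2 : ∀ i, ((e.toFun.comp (ξ i)).comp α.toFun).Homotopic f := by
    intro i
    have a : ((e.toFun.comp (ξ i)).comp α.toFun).Homotopic ((e.toFun.comp φ).comp α.toFun) :=
      ((ContinuousMap.Homotopic.refl _).comp (hξ i).symm).comp (ContinuousMap.Homotopic.refl _)
    have b : ((e.toFun.comp φ).comp α.toFun).Homotopic ((f.comp α.invFun).comp α.toFun) :=
      (e.right_inv.comp (ContinuousMap.Homotopic.refl (f.comp α.invFun))).comp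
        (ContinuousMap.Homotopic.refl α.toFun)
    exact (a.trans b).trans ((ContinuousMap.Homotopic.refl f).comp α.left_inv)
  exact ContinuousMap.Homotopic.pi h2

end Normal

theorem theorem1p11 {E B Y Z : Type u} [TopologicalSpace E] [TopologicalSpace B]
    [TopologicalSpace Y] [TopologicalSpace Z] (hB : HasCWHomotopyType B)
    (p : C(E, B)) (f : C(B, Y)) (j : C(E, Z)) (q : C(Z, Y))
    (hj : IsHurewiczCofibration j) (hq : IsHomotopyEquivalence q)
    (hqj : q.comp j = f.comp p) :
    fSecat p f =
      sInf ((fun n : ℕ => (n : ℕ∞)) '' {n : ℕ | HomotopyFactorsThroughFatWedge f j q n}) := by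

  have h : {n : ℕ | HasFCategoricalCover p f n} =
      {n : ℕ | HomotopyFactorsThroughFatWedge f j q n} :=
    Set.ext fun _ => ⟨homotopyFactorsThroughFatWedge_of_hasFCategoricalCover hB hq hqj,
      hasFCategoricalCover_of_homotopyFactorsThroughFatWedge hj hqj⟩
  rw [fSecat, h]
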